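/- Let $G$ be a finite group and let $H \le G$ be a subgroup. Put $\eta_H = \frac{1}{|H|}\sum_{h\in H} h \in \mathbb{C}[G]$, and let $E^\bullet(H)$ be the set of idempotents $e \in \mathbb{C}[H] \subseteq \mathbb{C}[G]$ such that $\eta_H e = \eta_H$. For $e \in E^\bullet(H)$ define $$\Theta(e) = \{ w \in \mathbb{C}[G] : e w (1-e) = 0,\ (e-\eta_H) w \eta_H = 0 \}.$$ Let $\Lambda : \mathbb{C}[G] \to \mathbb{C}[G/H]$ be the linear map with $\Lambda(g) = gH$ for $g \in G$, and for a subspace $M$ of $\mathbb{C}[G]$ let $M^\circ = M \cap \ker \Lambda$. For an irreducible complex representation $V$ of $G$, let $\chi_V$ be its character and let $\mathrm{Mat}(V) \subseteq \mathbb{C}[G]$ be the block of the Wedderburn decomposition of $\mathbb{C}[G]$ corresponding to $V$, that is, the sum of all left ideals of $\mathbb{C}[G]$ isomorphic to $V$. Let $\mathbb{1}\!\uparrow_H^G$ be the character of the representation of $G$ induced from the trivial representation of $H$ (the permutation character of $G$ acting on $G/H$), and let $\langle \chi, \psi\rangle = \frac{1}{|G|}\sum_{g \in G}\overline{\chi(g)}\psi(g)$.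 **Theorem.** Let $e, \tilde e \in E^\bullet(H)$, and set $L = \mathbb{C}[G]e$ and $\tilde L = \mathbb{C}[G]\tilde e$. Then $\Theta(e) \subseteq \Theta(\tilde e)$ if and only if for every irreducible representation $V$ of $G$ the following two conditions hold: 1. if $\langle \mathbb{1}\!\uparrow_H^G, \chi_V\rangle \neq 0$, then $\tilde L^\circ \cap \mathrm{Mat}(V) = L^\circ \cap \mathrm{Mat}(V)$; 2. $\tilde L^\circ \cap \mathrm{Mat}(V)$ is either $0$, or $L^\circ \cap \mathrm{Mat}(V)$, or $\mathrm{Mat}(V)$. -/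

import Mathlib

universe u

noncomputable section

namespace WeakLumping

variable {G : Type u} [Group G] [Fintype G] (H : Subgroup G)

open Classical in
/-- The uniform distribution `η_H = |H|⁻¹ ∑_{h ∈ H} h` on the subgroup `H`, as an element
of the group algebra `ℂ[G]`. -/
def eta : MonoidAlgebra ℂ G :=
  (Nat.card H : ℂ)⁻¹ • ∑ h : H, MonoidAlgebra.of ℂ G (h : G)

/-- `E•(H)`: the idempotents `e` of `ℂ[H]`, viewed inside `ℂ[G]`, such that `η_H e = η_H`. -/
def EBullet : Set (MonoidAlgebra ℂ G) :=
  {e | e ∈ (MonoidAlgebra.mapDomainAlgHom ℂ ℂ H.subtype).range ∧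
    IsIdempotentElem e ∧ eta H * e = eta H}

/-- The weak lumping algebra
`Θ(e) = {w ∈ ℂ[G] : e w (1 - e) = 0, (e - η_H) w η_H = 0}`. -/
def Theta (e : MonoidAlgebra ℂ G) : Set (MonoidAlgebra ℂ G) :=
  {w | e * w * (1 - e) = 0 ∧ (e - eta H) * w * eta H = 0}

/-- The left ideal `ℂ[G]e`, as a complex subspace of `ℂ[G]`. -/
def leftIdeal (e : MonoidAlgebra ℂ G) : Submodule ℂ (MonoidAlgebra ℂ G) :=
  (Submodule.span (MonoidAlgebra ℂ G) {e}).restrictScalars ℂ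

/-- The linear map `Λ : ℂ[G] → ℂ[G/H]` induced by `g ↦ gH`. -/
def cosetMap : MonoidAlgebra ℂ G →ₗ[ℂ] MonoidAlgebra ℂ (G ⧸ H) :=
  MonoidAlgebra.mapDomainLinearMap ℂ ℂ (fun g : G => (g : G ⧸ H))

/-- `V° = V ∩ ker Λ` for a subspace `V` of `ℂ[G]`. -/
def circ (V : Submodule ℂ (MonoidAlgebra ℂ G)) : Submodule ℂ (MonoidAlgebra ℂ G) :=
  V ⊓ LinearMap.ker (cosetMap H)

/-- The Wedderburn block `Mat(V)` of `ℂ[G]` belonging to an irreducible representation `V`: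
the sum of all left ideals of `ℂ[G]` isomorphic to `V`, as a complex subspace. -/
def block {V : Type u} [AddCommGroup V] [Module ℂ V] (ρ : Representation ℂ G V) :
    Submodule ℂ (MonoidAlgebra ℂ G) :=
  (isotypicComponent (MonoidAlgebra ℂ G) (MonoidAlgebra ℂ G) ρ.asModule).restrictScalars ℂ

/-- The inner product `⟨χ, ψ⟩ = |G|⁻¹ ∑_g conj (χ g) ψ g`. -/
def charInner (χ ψ : G → ℂ) : ℂ :=
  (Nat.card G : ℂ)⁻¹ * ∑ g : G, starRingEnd ℂ (χ g) * ψ g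

/-- The character of the representation of `G` induced from the trivial representation of `H`,
that is, the permutation character of `G` on `G/H`. -/
def inducedTrivialCharacter : G → ℂ :=
  (Representation.ind H.subtype (Representation.trivial ℂ H ℂ)).character

end WeakLumping

end

/-! Put `η = eta H` and `f = e - η`. Then `1 - e`, `η`, `f` are orthogonal idempotents with sum 1,
and on an irreducible `V` the equations defining `Θ(e)` say that `w` stabilizes the flag `ker e ⊆
ker f`, where `ker f = ker e ⊕ im η`. By semisimplicity the inclusion can be tested on each `V`
separately. If `η` is 0 on `V`, the flag is a single subspace, and its stabilizer preserves only
`0`, that subspace and `V`; so `f'` is 1, has the kernel of `f`, or is 0. If `η ≠ 0` on `V`, the two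
steps of the flag differ by `im η`, which forces `ker f' = ker f`; this determines the flag, since
`ker e = ker f ∩ ker η`. On the ideal side `L° = ℂ[G]f`, so `L° ∩ Mat(V)` consists of the block
elements whose action kills `ker f`. It therefore records exactly `ker f`, and the three cases
become `Mat(V)`, `L° ∩ Mat(V)` and `0`. Finally, `η ≠ 0` on `V` means that `V` has nonzero `H`-fixed
vectors, which Frobenius reciprocity turns into the character condition. The flag argument is
carried out in `flagStabilizer_subset_iff` using only that the ring is prime; equality of kernels
appears there as `f' * f = f'` and `f * f' = f`. -/

namespace WeakLumping

/-! ### Stabilizers of two-step flags in a prime ring -/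

section FlagStabilizer

variable {R : Type*} [Ring R]

/-- Inclusion of stabilizers of the flags attached to `e` and `e'` in a prime ring. -/
theorem flagStabilizer_subset_iff
    (hprime : ∀ x y : R, (∀ a, x * a * y = 0) → x = 0 ∨ y = 0) {h e e' : R}
    (hh : h * h = h) (he : e * e = e) (hhe : h * e = h) (heh : e * h = h)
    (he' : e' * e' = e') (hhe' : h * e' = h) (heh' : e' * h = h) :
    (∀ w, e * w * (1 - e) = 0 ∧ (e - h) * w * h = 0 →
        e' * w * (1 - e') = 0 ∧ (e' - h) * w * h = 0) ↔
      (h ≠ 0 → (e' - h) * (e - h) = e' - h ∧ (e - h) * (e' - h) = e - h) ∧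
      (e' - h = 0 ∨ ((e' - h) * (e - h) = e' - h ∧ (e - h) * (e' - h) = e - h) ∨
        e' - h = 1) := by
  obtain ⟨f, rfl⟩ : ∃ f, e = f + h := ⟨e - h, by simp⟩
  obtain ⟨f', rfl⟩ : ∃ f', e' = f' + h := ⟨e' - h, by simp⟩
  have hf : h * f = 0 := by simpa [mul_add, hh] using hhe
  have fh : f * h = 0 := by simpa [add_mul, hh] using heh
  have hf' : h * f' = 0 := by simpa [mul_add, hh] using hhe'
  have fh' : f' * h = 0 := by simpa [add_mul, hh] using heh'
  have ff : f * f = f := by simpa [add_mul, mul_add, hh, hf, fh] using he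
  have ff' : f' * f' = f' := by simpa [add_mul, mul_add, hh, hf', fh'] using he'
  simp only [add_sub_cancel_right]
  constructor
  · intro H
    -- Two families of test elements suffice: `(1 - e) * a`, with image in `ker e`, and, below, `a *
    -- f`, which kills `ker f`. Both stabilize the flag of `e`.
    have Hg : ∀ a, (f' + h) * ((1 - (f + h)) * a) * (1 - (f' + h)) = 0 ∧
        f' * ((1 - (f + h)) * a) * h = 0 := fun a ↦ H _ <| by
      constructor <;> simp [← mul_assoc, mul_sub, add_mul, mul_add, hh, hf, fh, ff]
    have Hf : ∀ a, (f' + h) * (a * f) * (1 - (f' + h)) = 0 := fun a ↦ (H _ <| by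
      constructor <;> simp [mul_assoc, mul_sub, add_mul, mul_add, fh, ff]).1
    -- the part of the relations that concerns `f'`
    have Kg : f' * (1 - (f + h)) = 0 ∨ 1 - f' = 0 := hprime _ _ fun a ↦ by
      have h1 : f' * ((f' + h) * ((1 - (f + h)) * a) * (1 - (f' + h))) = 0 := by
        rw [(Hg a).1, mul_zero]
      have h2 : f' * (f' + h) = f' := by rw [mul_add, ff', fh', add_zero]
      rw [← mul_assoc, ← mul_assoc, h2] at h1
      have h3 := (Hg a).2
      rw [← mul_assoc] at h1 h3
      -- The two equations of the stabilizer add up to one because `1 - f' = (1 - e') + h`.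
      rw [show 1 - f' = 1 - (f' + h) + h by abel, mul_add, h1, h3, add_zero]
    have Kf : f' = 0 ∨ f * (1 - f') = 0 := by
      refine hprime _ _ fun a ↦ ?_
      have h1 : f' * ((f' + h) * (a * f) * (1 - (f' + h))) = 0 := by
        rw [Hf a, mul_zero]
      have h2 : f' * (f' + h) = f' := by rw [mul_add, ff', fh', add_zero]
      rw [← mul_assoc, ← mul_assoc, h2] at h1
      have h3 : f * (1 - (f' + h)) = f * (1 - f') := by simp [mul_sub, mul_add, fh]
      rw [← h3]
      simpa only [mul_assoc] using h1
    have kg : f' * (1 - (f + h)) = 0 → f' * f = f' := fun k ↦ by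
      simp [mul_sub, mul_add, fh'] at k
      exact (sub_eq_zero.1 k).symm
    have kf : f * (1 - f') = 0 → f * f' = f := fun k ↦ by
      rw [mul_sub, mul_one] at k
      exact (sub_eq_zero.1 k).symm
    constructor
    · intro h0
      -- A nonzero `h` excludes the degenerate cases: `e' = 0` contradicts `e' * h = h`, and `f' =
      -- 1` contradicts `f' * h = 0`.
      have e0 : f' + h ≠ 0 := fun h1 ↦ h0 <| by rw [← heh', h1, zero_mul]
      have f1 : ¬ (1 - f' = 0) := fun h1 ↦ h0 <| by
        rw [← sub_eq_zero.1 h1, one_mul] at fh'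
        exact fh'
      refine ⟨kg (Kg.resolve_right f1), ?_⟩
      have h3 : f * (1 - (f' + h)) = 0 := (hprime _ _ fun a ↦ by
        simpa only [mul_assoc] using Hf a).resolve_left e0
      exact kf (by simpa [mul_sub, mul_add, fh] using h3)
    · rcases Kg with Kg | Kg
      · rcases Kf with Kf | Kf
        · exact Or.inl Kf
        · exact Or.inr (Or.inl ⟨kg Kg, kf Kf⟩)
      · exact Or.inr (Or.inr (sub_eq_zero.1 Kg).symm)
  · rintro ⟨H1, H2⟩ w ⟨w1, w2⟩
    by_cases hS : f' * f = f' ∧ f * f' = f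
    · obtain ⟨s1, s2⟩ := hS
      constructor
      · have a1 : (f' + h) * (f + h) = f' + h := by simp [add_mul, mul_add, s1, fh', hf, hh]
        have a2 : (1 - (f + h)) * (1 - (f' + h)) = 1 - (f' + h) := by
          simp [sub_mul, mul_sub, add_mul, mul_add, s2, fh, hf', hh]
          abel
        calc (f' + h) * w * (1 - (f' + h))
            = (f' + h) * ((f + h) * w * (1 - (f + h))) * (1 - (f' + h)) := by
              rw [← mul_assoc, ← mul_assoc, a1, mul_assoc _ (1 - (f + h)), a2]
          _ = 0 := by rw [w1]; simp
      · rw [← s1, mul_assoc f', mul_assoc f', w2, mul_zero]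
    · have h0 : h = 0 := by_contra fun h0 ↦ hS (H1 h0)
      subst h0
      rcases H2 with H2 | H2 | H2
      · simp [H2]
      · exact absurd H2 hS
      · simp [H2]

end FlagStabilizer

/-! ### Blocks of a semisimple ring acting on a simple module -/

section Isotypic

variable {A V : Type*} [Ring A] [AddCommGroup V] [Module A V] [IsSimpleModule A V]

/-- A simple left ideal not isomorphic to the simple module `V` annihilates `V`. -/
theorem smul_eq_zero_of_not_equiv {S : Submodule A A} [IsSimpleModule A S]
    (hS : ¬ Nonempty (S ≃ₗ[A] V)) {x : A} (hx : x ∈ S) (v : V) : x • v = 0 := by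
  have := (LinearMap.bijective_or_eq_zero
    ((LinearMap.toSpanSingleton A V v).comp S.subtype)).resolve_left
      fun h ↦ hS ⟨LinearEquiv.ofBijective _ h⟩
  simpa using LinearMap.congr_fun this ⟨x, hx⟩

variable [IsSemisimpleRing A]

/-- An element of a semisimple ring which annihilates all simple left ideals is zero. -/
theorem eq_zero_of_forall_simple {x : A}
    (hx : ∀ S : Submodule A A, IsSimpleModule A S → ∀ s ∈ S, x * s = 0) : x = 0 := by
  have h : ∀ y ∈ sSup {S : Submodule A A | IsSimpleModule A S}, x * y = 0 := fun y hy ↦ by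
    rw [sSup_eq_iSup] at hy
    induction hy using Submodule.iSup_induction' with
    | mem S y hy =>
      by_cases hS : IsSimpleModule A S
      · exact hx S hS y (by simpa [hS] using hy)
      · have : y = 0 := by simpa [hS] using hy
        simp [this]
    | zero => simp
    | add y z _ _ hy hz => rw [mul_add, hy, hz, add_zero]
  simpa using h 1 (by rw [IsSemisimpleModule.sSup_simples_eq_top]; trivial)

/-- The block acts faithfully on `V`: its elements already kill every simple left ideal not
isomorphic to `V`, and one that also kills `V` kills the whole ring. -/
theorem eq_zero_of_mem_isotypicComponent {x : A} (hx : x ∈ isotypicComponent A A V)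
    (hV : ∀ v : V, x • v = 0) : x = 0 := by
  refine eq_zero_of_forall_simple fun S hS s hs ↦ ?_
  by_cases hSV : Nonempty (S ≃ₗ[A] V)
  · obtain ⟨φ⟩ := hSV
    have : x • (⟨s, hs⟩ : S) = 0 := φ.injective (by rw [map_smul, hV, map_zero])
    simpa using congrArg Subtype.val this
  · have : isotypicComponent A A V ≤ LinearMap.ker (LinearMap.toSpanSingleton A A s) := by
      refine sSup_le fun T hT t ht ↦ ?_
      obtain ⟨φ⟩ : Nonempty (T ≃ₗ[A] V) := hT
      have := IsSimpleModule.congr φ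
      have h := smul_eq_zero_of_not_equiv (S := T) (V := S)
        (fun ⟨ψ⟩ ↦ hSV ⟨ψ.symm.trans φ⟩) ht ⟨s, hs⟩
      simpa using congrArg Subtype.val h
    simpa using this hx

-- Simple left ideals isomorphic to `V` lie in the block and all others annihilate `V`, so the ring
-- is the sum of the block and the annihilator of `V`.
variable (V) in
theorem exists_mem_isotypicComponent_smul_eq (a : A) :
    ∃ x ∈ isotypicComponent A A V, ∀ v : V, x • v = a • v := by
  have h : (⊤ : Submodule A A) ≤ isotypicComponent A A V ⊔ Module.annihilator A V := by
    rw [← IsSemisimpleModule.sSup_simples_eq_top]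
    refine sSup_le fun S (hS : IsSimpleModule A S) ↦ ?_
    by_cases hSV : Nonempty (S ≃ₗ[A] V)
    · exact (le_sSup (a := S) hSV).trans le_sup_left
    · exact le_trans (fun x hx ↦ Module.mem_annihilator.2 (smul_eq_zero_of_not_equiv hSV hx))
        le_sup_right
  obtain ⟨x, hx, y, hy, rfl⟩ := Submodule.mem_sup.1 (h (Submodule.mem_top (x := a)))
  exact ⟨x, hx, fun v ↦ by rw [add_smul, Module.mem_annihilator.1 hy v, add_zero]⟩

-- Right multiplication is an endomorphism of the left regular module, and isotypic components are
-- fully invariant.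
omit [IsSemisimpleRing A] in
theorem mul_mem_isotypicComponent {x : A} (hx : x ∈ isotypicComponent A A V) (a : A) :
    x * a ∈ isotypicComponent A A V :=
  Submodule.IsFullyInvariant.isotypicComponent A A V
    (LinearMap.toSpanSingleton A A a) hx

omit [IsSemisimpleRing A] in
/-- The annihilator of a simple module is a prime ideal. -/
theorem annihilates_or_of_forall_mul {x y : A} (h : ∀ (a : A) (v : V), (x * a * y) • v = 0) :
    (∀ v : V, x • v = 0) ∨ ∀ v : V, y • v = 0 := by
  by_contra! hc
  obtain ⟨⟨v, hv⟩, w, hw⟩ := hc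
  obtain ⟨a, ha⟩ := IsSimpleModule.toSpanSingleton_surjective A hw v
  apply hv
  rw [← ha, LinearMap.toSpanSingleton_apply, ← mul_smul, ← mul_smul]
  exact h a w

end Isotypic
end WeakLumping
namespace WeakLumping
open Representation
open scoped Matrix ComplexOrder

/-! ### Characters and intertwining maps -/

section Character

variable {G V : Type*} [Group G] [Fintype G] [AddCommGroup V] [Module ℂ V] [FiniteDimensional ℂ V]

/-- Characters of a finite group over `ℂ` satisfy `χ(g⁻¹) = conj χ(g)`. -/
theorem character_inv (ρ : Representation ℂ G V) (g : G) :
    ρ.character g⁻¹ = starRingEnd ℂ (ρ.character g) := by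
  classical
  let b := Module.finBasis ℂ V
  let M : G → Matrix _ _ ℂ := fun x ↦ LinearMap.toMatrix b b (ρ x)
  have hM : ∀ x y, M (x * y) = M x * M y := fun x y ↦ by
    simp only [M, map_mul, Module.End.mul_eq_comp, LinearMap.toMatrix_comp b b b]
  have hM1 : M 1 = 1 := by simp [M, Module.End.one_eq_id]
  -- Weyl's averaging trick: `P` is a `G`-invariant Hermitian form, positive definite because the
  -- term at `x = 1` is the identity. Hence `M g⁻¹` is conjugate by `P` to `(M g)ᴴ`.
  let P := ∑ x, (M x)ᴴ * M x
  have hP : P.PosDef := by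
    simp only [P]
    rw [← Finset.add_sum_erase _ _ (Finset.mem_univ (1 : G))]
    refine Matrix.PosDef.add_posSemidef ?_ (Matrix.posSemidef_sum _ fun x _ ↦
      Matrix.posSemidef_conjTranspose_mul_self _)
    simpa [hM1] using Matrix.PosDef.one
  have hPu : IsUnit P.det := (Matrix.isUnit_iff_isUnit_det P).1 hP.isUnit
  have inv : (M g)ᴴ * P * M g = P := by
    simp only [P, Finset.mul_sum, Finset.sum_mul]
    refine Fintype.sum_equiv (Equiv.mulRight g) _ _ fun x ↦ ?_
    simp only [Equiv.coe_mulRight, hM, Matrix.conjTranspose_mul, mul_assoc]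
  have key : M g⁻¹ = P⁻¹ * ((M g)ᴴ * P) := by
    have : (M g)ᴴ * P = P * M g⁻¹ := by
      calc (M g)ᴴ * P = ((M g)ᴴ * P * M g) * M g⁻¹ := by
            rw [mul_assoc _ (M g), ← hM, mul_inv_cancel, hM1, mul_one]
        _ = _ := by rw [inv]
    rw [this, Matrix.nonsing_inv_mul_cancel_left _ _ hPu]
  have htr : ∀ x, ρ.character x = (M x).trace := fun x ↦
    LinearMap.trace_eq_matrix_trace ℂ b (ρ x)
  rw [htr, htr, key, Matrix.trace_mul_comm, Matrix.mul_nonsing_inv_cancel_right _ _ hPu,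
    Matrix.trace_conjTranspose, starRingEnd_apply]

/-- The inner product is the dimension of the space of intertwining maps. -/
theorem charInner_character_ne_zero_iff {W : Type*} [AddCommGroup W] [Module ℂ W]
    [FiniteDimensional ℂ W] (ρ : Representation ℂ G V) (σ : Representation ℂ G W) :
    charInner ρ.character σ.character ≠ 0 ↔ ∃ f : IntertwiningMap ρ σ, f ≠ 0 := by
  have : Invertible (Nat.card G : ℂ) := invertibleOfNonzero (by simp)
  have h : charInner ρ.character σ.character = Module.finrank ℂ (IntertwiningMap ρ σ) := by
    rw [← card_inv_mul_sum_char_mul_char_eq_finrank, charInner]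
    simp_rw [character_inv ρ, mul_comm]
  have : Module.Finite ℂ (IntertwiningMap ρ σ) :=
    Module.Finite.equiv (invariantsEquivIntertwiningMap ρ σ)
  rw [h, Nat.cast_ne_zero, ← Nat.pos_iff_ne_zero, Module.finrank_pos_iff_exists_ne_zero]

end Character

/-! ### Fixed vectors and the permutation character -/

section Frobenius

variable {G : Type u} [Group G] [Fintype G] (H : Subgroup G)
  {V : Type*} [AddCommGroup V] [Module ℂ V] (ρ : Representation ℂ G V)

omit [Fintype G] in
/-- Frobenius reciprocity for the trivial representation. -/
theorem exists_intertwiningMap_ind_trivial_ne_zero_iff :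
    (∃ f : IntertwiningMap (ind H.subtype (trivial ℂ H ℂ)) ρ, f ≠ 0) ↔
      ∃ v : V, v ≠ 0 ∧ ∀ h ∈ H, ρ h v = v := by
  constructor
  · rintro ⟨f, hf⟩
    -- The generator at the identity is `H`-fixed and its `G`-translates span the induced
    -- representation, so its image is fixed, and vanishes only if `f` does.
    refine ⟨f (IndV.mk H.subtype (trivial ℂ H ℂ) 1 1), fun h0 ↦ hf ?_, fun h hh ↦ ?_⟩
    · apply IntertwiningMap.ext
      refine IndV.hom_ext _ _ fun g ↦ LinearMap.ext_ring ?_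
      have := f.isIntertwining _ _ g⁻¹ (IndV.mk H.subtype (trivial ℂ H ℂ) 1 1)
      rw [ind_mk, h0, map_zero] at this
      simpa using this
    · rw [← f.isIntertwining _ _ h, ind_mk]
      congr 1
      have := Coinvariants.mk_inv_tmul (leftRegular ℂ G |>.comp H.subtype) (trivial ℂ H ℂ)
        (MonoidAlgebra.single 1 1) 1 ⟨h, hh⟩
      simpa using this
  · rintro ⟨v, hv, hH⟩
    -- The inverse in `ρ g⁻¹ v` reflects that `G` acts on the generators of `IndV` by right
    -- translation by inverses; `H`-invariance of `v` lets the map descend to coinvariants.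
    let F : IndV H.subtype (trivial ℂ H ℂ) →ₗ[ℂ] V := Coinvariants.lift _
      (TensorProduct.lift <| (Finsupp.lift _ _ _ fun g ↦
        LinearMap.toSpanSingleton ℂ V (ρ g⁻¹ v)) ∘ₗ
        (MonoidAlgebra.coeffLinearEquiv ℂ).toLinearMap)
      fun h ↦ by
        ext g
        simp [hH _ (H.inv_mem h.2)]
    have hF : ∀ g, F (IndV.mk H.subtype (trivial ℂ H ℂ) g 1) = ρ g⁻¹ v := fun g ↦ by
      simp [F]
    refine ⟨⟨F, fun g ↦ ?_⟩, fun h0 ↦ hv ?_⟩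
    · refine IndV.hom_ext _ _ fun x ↦ LinearMap.ext_ring ?_
      change F (ind _ _ g (IndV.mk _ _ x 1)) = ρ g (F (IndV.mk _ _ x 1))
      rw [ind_mk, hF, hF]
      simp
    · have := hF 1
      rw [inv_one, map_one ρ, Module.End.one_apply] at this
      exact this.symm.trans (LinearMap.congr_fun (congrArg IntertwiningMap.toLinearMap h0) _)

open Classical in
theorem asAlgebraHom_eta_apply (v : V) :
    ρ.asAlgebraHom (eta H) v = (Nat.card H : ℂ)⁻¹ • ∑ h : H, ρ (h : G) v := by
  simp [eta]

/-- Averaging over `H` projects onto the `H`-fixed vectors, so a nonzero fixed vector exists exactly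
when `η_H` acts nontrivially. -/
theorem charInner_inducedTrivialCharacter_ne_zero_iff [FiniteDimensional ℂ V] :
    charInner (inducedTrivialCharacter H) ρ.character ≠ 0 ↔
      ∃ v : V, ρ.asAlgebraHom (eta H) v ≠ 0 := by
  classical
  rw [inducedTrivialCharacter, charInner_character_ne_zero_iff,
    exists_intertwiningMap_ind_trivial_ne_zero_iff]
  simp only [asAlgebraHom_eta_apply]
  constructor
  · rintro ⟨v, hv, h⟩
    refine ⟨v, ?_⟩
    rw [Finset.sum_congr rfl fun (x : H) _ ↦ h x x.2]
    simpa [← Nat.cast_smul_eq_nsmul ℂ] using hv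
  · rintro ⟨v, hv⟩
    refine ⟨_, hv, fun h hh ↦ ?_⟩
    rw [map_smul, map_sum]
    congr 1
    refine Fintype.sum_equiv (Equiv.mulLeft (⟨h, hh⟩ : H)) _ _ fun x ↦ ?_
    simp

end Frobenius
end WeakLumping
namespace WeakLumping

/-! ### Left ideals inside a block, read off from the action -/

section Corner

variable {A R : Type*} [Ring A] [Ring R] {B : Submodule A A} {ψ : A →+* R}

/-- Comparison of the left ideals `{x ∈ B | x f = x}` of a two-sided ideal `B` through a ring
homomorphism that is bijective on `B`. -/
theorem fixed_subset_iff (hB : ∀ x ∈ B, ∀ a, x * a ∈ B) (inj : ∀ x ∈ B, ψ x = 0 → x = 0)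
    (surj : ∀ r, ∃ x ∈ B, ψ x = r) {f f' : A} (hf : f * f = f) :
    (∀ x ∈ B, x * f = x → x * f' = x) ↔ ψ f * ψ f' = ψ f := by
  have mem : ∀ x ∈ B, ∀ f, x * f = x ↔ ψ x * ψ f = ψ x := fun x hx f ↦ by
    refine ⟨fun h ↦ by rw [← map_mul, h], fun h ↦ sub_eq_zero.1 <|
      inj _ (B.sub_mem (hB x hx f) hx) ?_⟩
    rw [map_sub, map_mul, h, sub_self]
  constructor
  · intro h
    obtain ⟨x, hx, hxf⟩ := surj (ψ f)
    rw [← hxf, ← mem x hx]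
    refine h x hx ?_
    rw [mem x hx, hxf, ← map_mul, hf]
  · intro h x hx hxf
    rw [mem x hx] at hxf ⊢
    rw [← hxf, mul_assoc, h]

theorem fixed_eq_zero_iff (hB : ∀ x ∈ B, ∀ a, x * a ∈ B) (inj : ∀ x ∈ B, ψ x = 0 → x = 0)
    (surj : ∀ r, ∃ x ∈ B, ψ x = r) {f : A} (hf : f * f = f) :
    (∀ x ∈ B, x * f = x → x = 0) ↔ ψ f = 0 := by
  have := fixed_subset_iff hB inj surj (f' := 0) hf
  simpa [eq_comm] using this

theorem fixed_eq_self_iff (hB : ∀ x ∈ B, ∀ a, x * a ∈ B) (inj : ∀ x ∈ B, ψ x = 0 → x = 0)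
    (surj : ∀ r, ∃ x ∈ B, ψ x = r) {f : A} :
    (∀ x ∈ B, x * f = x) ↔ ψ f = 1 := by
  have := fixed_subset_iff hB inj surj (f := 1) (f' := f) (mul_one 1)
  simpa using this

end Corner

/-! ### The group algebra: `Θ(e)` and `L°` block by block -/

section EBullet

variable {G : Type u} [Group G] [Fintype G] {H : Subgroup G} {e : MonoidAlgebra ℂ G}

theorem single_mul_eta {h : G} (hh : h ∈ H) : MonoidAlgebra.single h (1 : ℂ) * eta H = eta H := by
  classical
  rw [eta, mul_smul_comm, Finset.mul_sum]
  congr 1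
  refine Fintype.sum_equiv (Equiv.mulLeft (⟨h, hh⟩ : H)) _ _ fun x ↦ ?_
  simp [MonoidAlgebra.single_mul_single]

theorem eta_mul_single {h : G} (hh : h ∈ H) : eta H * MonoidAlgebra.single h (1 : ℂ) = eta H := by
  classical
  rw [eta, smul_mul_assoc, Finset.sum_mul]
  congr 1
  refine Fintype.sum_equiv (Equiv.mulRight (⟨h, hh⟩ : H)) _ _ fun x ↦ ?_
  simp [MonoidAlgebra.single_mul_single]

theorem eta_mul_eta : eta H * eta H = eta H := by
  classical
  conv_lhs => enter [1]; rw [eta]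
  rw [smul_mul_assoc, Finset.sum_mul]
  simp only [MonoidAlgebra.of_apply]
  rw [Finset.sum_congr rfl fun (h : H) _ ↦ single_mul_eta h.2]
  simp [← Nat.cast_smul_eq_nsmul ℂ]

theorem eta_commute {x : MonoidAlgebra ℂ G}
    (hx : x ∈ (MonoidAlgebra.mapDomainAlgHom ℂ ℂ H.subtype).range) : x * eta H = eta H * x := by
  obtain ⟨y, rfl⟩ := hx
  change MonoidAlgebra.mapDomainAlgHom ℂ ℂ H.subtype y * eta H =
    eta H * MonoidAlgebra.mapDomainAlgHom ℂ ℂ H.subtype y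
  induction y using MonoidAlgebra.induction_on with
  | of h => simp [single_mul_eta h.2, eta_mul_single h.2]
  | add a b ha hb => simp only [map_add, add_mul, mul_add, ha, hb]
  | smul c a ha => rw [map_smul, smul_mul_assoc, mul_smul_comm, ha]

theorem EBullet.mul_self (he : e ∈ EBullet H) : e * e = e := he.2.1

theorem EBullet.eta_mul (he : e ∈ EBullet H) : eta H * e = eta H := he.2.2

theorem EBullet.mul_eta (he : e ∈ EBullet H) : e * eta H = eta H := by
  rw [eta_commute he.1, EBullet.eta_mul he]

theorem EBullet.sub_eta_mul_self (he : e ∈ EBullet H) :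
    (e - eta H) * (e - eta H) = e - eta H := by
  simp [sub_mul, mul_sub, EBullet.mul_self he, EBullet.eta_mul he, EBullet.mul_eta he, eta_mul_eta]

/-- The kernel of `Λ` is the left annihilator of `η_H`. -/
theorem cosetMap_eq_zero_iff (x : MonoidAlgebra ℂ G) : cosetMap H x = 0 ↔ x * eta H = 0 := by
  classical
  constructor
  · let F : MonoidAlgebra ℂ (G ⧸ H) →ₗ[ℂ] MonoidAlgebra ℂ G :=
      (Finsupp.lift _ ℂ _ fun q : G ⧸ H ↦ MonoidAlgebra.single q.out 1 * eta H) ∘ₗ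
        (MonoidAlgebra.coeffLinearEquiv ℂ).toLinearMap
    have hF : F ∘ₗ cosetMap H = LinearMap.mulRight ℂ (eta H) := by
      refine MonoidAlgebra.lhom_ext' fun g ↦ LinearMap.ext_ring ?_
      obtain ⟨h, hh⟩ := QuotientGroup.mk_out_eq_mul H g
      have : MonoidAlgebra.single (g * h : G) (1 : ℂ) =
          MonoidAlgebra.single g 1 * MonoidAlgebra.single (h : G) 1 := by
        rw [MonoidAlgebra.single_mul_single, one_mul]
      have hF1 : F (cosetMap H (MonoidAlgebra.single g 1)) =
          MonoidAlgebra.single (g : G ⧸ H).out 1 * eta H := by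
        simp [F, cosetMap]
      change F (cosetMap H (MonoidAlgebra.single g 1)) = MonoidAlgebra.single g 1 * eta H
      rw [hF1, hh, this, mul_assoc, single_mul_eta h.2]
    intro h
    have := LinearMap.congr_fun hF x
    rwa [LinearMap.comp_apply, h, map_zero, LinearMap.mulRight_apply, eq_comm] at this
  · have hF : cosetMap H ∘ₗ LinearMap.mulRight ℂ (eta H) = cosetMap H := by
      refine MonoidAlgebra.lhom_ext' fun g ↦ LinearMap.ext_ring ?_
      have : ∀ h : H, ((g * h : G) : G ⧸ H) = g := fun h ↦ QuotientGroup.mk_mul_of_mem g h.2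
      simp [eta, cosetMap, Finset.mul_sum, MonoidAlgebra.single_mul_single, this,
        ← Nat.cast_smul_eq_nsmul ℂ]
    intro h
    rw [← hF, LinearMap.comp_apply, LinearMap.mulRight_apply, h, map_zero]

omit [Fintype G] in
theorem mem_leftIdeal_iff (he : e * e = e) (x : MonoidAlgebra ℂ G) :
    x ∈ leftIdeal e ↔ x * e = x := by
  rw [leftIdeal, Submodule.restrictScalars_mem, Submodule.mem_span_singleton]
  constructor
  · rintro ⟨a, rfl⟩
    rw [smul_eq_mul, mul_assoc, he]
  · exact fun h ↦ ⟨x, h⟩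

/-- `L°` is the left ideal generated by the idempotent `e - η_H`, since `ker Λ` is the left
annihilator of `η_H`. -/
theorem mem_circ_leftIdeal_iff (he : e ∈ EBullet H) (x : MonoidAlgebra ℂ G) :
    x ∈ circ H (leftIdeal e) ↔ x * (e - eta H) = x := by
  rw [circ, Submodule.mem_inf, LinearMap.mem_ker, cosetMap_eq_zero_iff,
    mem_leftIdeal_iff (EBullet.mul_self he)]
  constructor
  · rintro ⟨h1, h2⟩
    rw [mul_sub, h1, h2, sub_zero]
  · intro h
    constructor
    · rw [← h, mul_assoc, sub_mul, EBullet.mul_self he, EBullet.eta_mul he]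
    · rw [← h, mul_assoc, sub_mul, EBullet.mul_eta he, eta_mul_eta, sub_self, mul_zero]

/-- The theorem for one simple module: the flag criterion is applied in the ring of operators by
which the group algebra acts on `V`, and each of its relations is translated into one between left
ideals in the block. -/
theorem flagStabilizer_subset_iff_of_isSimpleModule {e' : MonoidAlgebra ℂ G}
    (he : e ∈ EBullet H) (he' : e' ∈ EBullet H)
    (V : Type*) [AddCommGroup V] [Module (MonoidAlgebra ℂ G) V]
    [IsSimpleModule (MonoidAlgebra ℂ G) V] (B : Submodule ℂ (MonoidAlgebra ℂ G))
    (hB : B = (isotypicComponent (MonoidAlgebra ℂ G) (MonoidAlgebra ℂ G) V).restrictScalars ℂ) :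
    (∀ w : MonoidAlgebra ℂ G,
        (∀ v : V, (e * w * (1 - e)) • v = 0) ∧ (∀ v : V, ((e - eta H) * w * eta H) • v = 0) →
        (∀ v : V, (e' * w * (1 - e')) • v = 0) ∧
          (∀ v : V, ((e' - eta H) * w * eta H) • v = 0)) ↔
      ((∃ v : V, eta H • v ≠ 0) → circ H (leftIdeal e') ⊓ B = circ H (leftIdeal e) ⊓ B) ∧
      (circ H (leftIdeal e') ⊓ B = ⊥ ∨
        circ H (leftIdeal e') ⊓ B = circ H (leftIdeal e) ⊓ B ∨
        circ H (leftIdeal e') ⊓ B = B) := by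
  subst hB
  let A := MonoidAlgebra ℂ G
  have : IsSemisimpleRing A := inferInstance
  -- Taking the image of the action as target makes `ψ` surjective by construction; simplicity of
  -- `V` makes this image prime, so it need not be identified with a full endomorphism ring.
  let ψ := (Module.toAddMonoidEnd A V).rangeRestrict
  have hψ : ∀ x, ψ x = 0 ↔ ∀ v : V, x • v = 0 := fun x ↦ by
    rw [← Subtype.coe_inj]
    exact DFunLike.ext_iff
  have hsurj : Function.Surjective ψ := RingHom.rangeRestrict_surjective _
  let B := isotypicComponent A A V
  have hB : ∀ x ∈ B, ∀ a, x * a ∈ B := fun x hx a ↦ mul_mem_isotypicComponent hx a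
  have inj : ∀ x ∈ B, ψ x = 0 → x = 0 := fun x hx h ↦
    eq_zero_of_mem_isotypicComponent hx ((hψ x).1 h)
  have surj : ∀ r, ∃ x ∈ B, ψ x = r := fun r ↦ by
    obtain ⟨a, rfl⟩ := hsurj r
    obtain ⟨x, hx, h⟩ := exists_mem_isotypicComponent_smul_eq V a
    refine ⟨x, hx, ?_⟩
    rw [← sub_eq_zero, ← map_sub, hψ]
    intro v
    rw [sub_smul, h, sub_self]
  have hprime : ∀ x y : (Module.toAddMonoidEnd A V).range,
      (∀ a, x * a * y = 0) → x = 0 ∨ y = 0 := by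
    intro x y h
    obtain ⟨x, rfl⟩ := hsurj x
    obtain ⟨y, rfl⟩ := hsurj y
    rw [hψ, hψ]
    refine annihilates_or_of_forall_mul fun a ↦ (hψ _).1 ?_
    rw [map_mul, map_mul, h]
  have key := flagStabilizer_subset_iff hprime (h := ψ (eta H)) (e := ψ e) (e' := ψ e')
    (by rw [← map_mul, eta_mul_eta]) (by rw [← map_mul, EBullet.mul_self he])
    (by rw [← map_mul, EBullet.eta_mul he]) (by rw [← map_mul, EBullet.mul_eta he])
    (by rw [← map_mul, EBullet.mul_self he'])
    (by rw [← map_mul, EBullet.eta_mul he']) (by rw [← map_mul, EBullet.mul_eta he'])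
  rw [hsurj.forall] at key
  have f1 := EBullet.sub_eta_mul_self he
  have f2 := EBullet.sub_eta_mul_self he'
  have hmem : ∀ {e} (_ : e ∈ EBullet H) (x : A),
      x ∈ circ H (leftIdeal e) ⊓ B.restrictScalars ℂ ↔ x ∈ B ∧ x * (e - eta H) = x :=
    fun he x ↦ by
      rw [Submodule.mem_inf, mem_circ_leftIdeal_iff he, Submodule.restrictScalars_mem, and_comm]
  have e1 : circ H (leftIdeal e') ⊓ B.restrictScalars ℂ = circ H (leftIdeal e) ⊓ B.restrictScalars ℂ ↔
      ψ (e' - eta H) * ψ (e - eta H) = ψ (e' - eta H) ∧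
        ψ (e - eta H) * ψ (e' - eta H) = ψ (e - eta H) := by
    rw [← fixed_subset_iff hB inj surj f2, ← fixed_subset_iff hB inj surj f1, le_antisymm_iff]
    simp only [SetLike.le_def, hmem he, hmem he']
    exact ⟨fun h ↦ ⟨fun x hx hf ↦ (h.1 ⟨hx, hf⟩).2, fun x hx hf ↦ (h.2 ⟨hx, hf⟩).2⟩,
      fun h ↦ ⟨fun x hx ↦ ⟨hx.1, h.1 x hx.1 hx.2⟩, fun x hx ↦ ⟨hx.1, h.2 x hx.1 hx.2⟩⟩⟩
  have e2 : circ H (leftIdeal e') ⊓ B.restrictScalars ℂ = ⊥ ↔ ψ (e' - eta H) = 0 := by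
    rw [← fixed_eq_zero_iff hB inj surj f2, Submodule.eq_bot_iff]
    simp only [hmem he', and_imp]
    exact Iff.rfl
  have e3 : circ H (leftIdeal e') ⊓ B.restrictScalars ℂ = B.restrictScalars ℂ ↔
      ψ (e' - eta H) = 1 := by
    rw [← fixed_eq_self_iff hB inj surj, le_antisymm_iff]
    simp only [SetLike.le_def, hmem he', Submodule.restrictScalars_mem]
    exact ⟨fun h x hx ↦ (h.2 hx).2, fun h ↦ ⟨fun x hx ↦ hx.1, fun x hx ↦ ⟨hx, h x hx⟩⟩⟩
  have e4 : (∃ v : V, eta H • v ≠ 0) ↔ ψ (eta H) ≠ 0 := by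
    rw [Ne, hψ, not_forall]
  rw [e1, e2, e3, e4]
  simp only [map_sub, ← key]
  simp only [← hψ, map_mul, map_sub, map_one]
  exact Iff.rfl

/-- Inclusion of weak lumping algebras is a blockwise condition. -/
theorem Theta_subset_iff_of_isSimpleModule {e' : MonoidAlgebra ℂ G} :
    Theta H e ⊆ Theta H e' ↔
      ∀ (V : Type u) [AddCommGroup V] [Module ℂ V] [FiniteDimensional ℂ V]
        (ρ : Representation ℂ G V) [ρ.IsIrreducible] (w : MonoidAlgebra ℂ G),
        (∀ v : ρ.asModule, (e * w * (1 - e)) • v = 0) ∧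
          (∀ v : ρ.asModule, ((e - eta H) * w * eta H) • v = 0) →
        (∀ v : ρ.asModule, (e' * w * (1 - e')) • v = 0) ∧
          (∀ v : ρ.asModule, ((e' - eta H) * w * eta H) • v = 0) := by
  constructor
  · intro h V _ _ _ ρ _ w ⟨h1, h2⟩
    -- Replace `w` by a block element `x` with the same action on `V`: all products containing `x`
    -- stay in the block, where vanishing on `V` means vanishing, so a condition on `V` alone
    -- becomes membership in `Θ(e)`.
    obtain ⟨x, hx, hxw⟩ := exists_mem_isotypicComponent_smul_eq ρ.asModule w
    have cong : ∀ (a b : MonoidAlgebra ℂ G) (v : ρ.asModule), (a * x * b) • v = (a * w * b) • v :=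
      fun a b v ↦ by simp only [mul_smul, hxw]
    have mem : ∀ a b, a * x * b ∈ isotypicComponent (MonoidAlgebra ℂ G) (MonoidAlgebra ℂ G)
        ρ.asModule := fun a b ↦
      mul_mem_isotypicComponent (Submodule.smul_mem _ a hx) b
    have hxe : x ∈ Theta H e :=
      ⟨eq_zero_of_mem_isotypicComponent (mem _ _) fun v ↦ by rw [cong, h1],
        eq_zero_of_mem_isotypicComponent (mem _ _) fun v ↦ by rw [cong, h2]⟩
    obtain ⟨h3, h4⟩ := h hxe
    exact ⟨fun v ↦ by rw [← cong, h3, zero_smul], fun v ↦ by rw [← cong, h4, zero_smul]⟩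
  · intro h w ⟨h1, h2⟩
    have h' : ∀ S : Submodule (MonoidAlgebra ℂ G) (MonoidAlgebra ℂ G),
        IsSimpleModule (MonoidAlgebra ℂ G) S →
        ∀ s ∈ S, e' * w * (1 - e') * s = 0 ∧ (e' - eta H) * w * eta H * s = 0 := by
      intro S hS s hs
      -- A simple left ideal is itself an irreducible representation in the same universe as `G`, so
      -- the hypothesis applies to it; `φ` carries the conclusion back to multiplication in the
      -- ideal.
      let ρ := Representation.ofModule' (k := ℂ) (G := G) S
      have smul_eq : ∀ (a : MonoidAlgebra ℂ G) (v : ρ.asModule),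
          ρ.asModuleEquiv (a • v) = (a • (ρ.asModuleEquiv v : S) : S) := fun a v ↦ by
        have : ρ.asAlgebraHom = Algebra.lsmul ℂ ℂ S := Equiv.apply_symm_apply _ _
        rw [Representation.asModuleEquiv_map_smul, this]
        rfl
      let φ : ρ.asModule ≃ₗ[MonoidAlgebra ℂ G] S :=
        { ρ.asModuleEquiv.toAddEquiv with map_smul' := smul_eq }
      have : ρ.IsIrreducible :=
        (Representation.irreducible_iff_isSimpleModule_asModule ρ).2 (IsSimpleModule.congr φ)
      have : FiniteDimensional ℂ S :=
        inferInstanceAs (FiniteDimensional ℂ (S.restrictScalars ℂ))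
      obtain ⟨h3, h4⟩ :=
        h S ρ w ⟨fun v ↦ by rw [h1, zero_smul], fun v ↦ by rw [h2, zero_smul]⟩
      have of_smul : ∀ a : MonoidAlgebra ℂ G, (∀ v : ρ.asModule, a • v = 0) → a * s = 0 :=
        fun a ha ↦ by
          have := congrArg φ (ha (φ.symm ⟨s, hs⟩))
          rw [map_smul, LinearEquiv.apply_symm_apply, map_zero] at this
          exact congrArg Subtype.val this
      exact ⟨of_smul _ h3, of_smul _ h4⟩
    exact ⟨eq_zero_of_forall_simple fun S hS s hs ↦ (h' S hS s hs).1,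
      eq_zero_of_forall_simple fun S hS s hs ↦ (h' S hS s hs).2⟩

end EBullet

end WeakLumping

theorem theorem7p6 {G : Type u} [Group G] [Fintype G] (H : Subgroup G)
    (e e' : MonoidAlgebra ℂ G)
    (he : e ∈ WeakLumping.EBullet H) (he' : e' ∈ WeakLumping.EBullet H) :
    WeakLumping.Theta H e ⊆ WeakLumping.Theta H e' ↔
      ∀ (V : Type u) [AddCommGroup V] [Module ℂ V] [FiniteDimensional ℂ V]
        (ρ : Representation ℂ G V) [ρ.IsIrreducible],
        (WeakLumping.charInner (WeakLumping.inducedTrivialCharacter H) ρ.character ≠ 0 →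
          WeakLumping.circ H (WeakLumping.leftIdeal e') ⊓ WeakLumping.block ρ =
            WeakLumping.circ H (WeakLumping.leftIdeal e) ⊓ WeakLumping.block ρ) ∧
        (WeakLumping.circ H (WeakLumping.leftIdeal e') ⊓ WeakLumping.block ρ = ⊥ ∨
          WeakLumping.circ H (WeakLumping.leftIdeal e') ⊓ WeakLumping.block ρ =
            WeakLumping.circ H (WeakLumping.leftIdeal e) ⊓ WeakLumping.block ρ ∨
          WeakLumping.circ H (WeakLumping.leftIdeal e') ⊓ WeakLumping.block ρ =
            WeakLumping.block ρ) := by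
  rw [WeakLumping.Theta_subset_iff_of_isSimpleModule]
  refine forall_congr' fun V ↦ forall_congr' fun _ ↦ forall_congr' fun _ ↦ forall_congr' fun _ ↦
    forall_congr' fun ρ ↦ forall_congr' fun _ ↦ ?_
  rw [WeakLumping.flagStabilizer_subset_iff_of_isSimpleModule he he' ρ.asModule _ rfl,
    WeakLumping.charInner_inducedTrivialCharacter_ne_zero_iff]
  rfl
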